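/- Let $K$ be an algebraically closed field and let $S=\bigoplus_{d\in\mathbb{N}}S_d$ be a commutative $\mathbb{N}$-graded $K$-algebra (neither $S$ Noetherian, nor $S_0=K$, nor that $S$ is a domain is assumed). Let $F_1,\dots,F_n\in S$ be homogeneous elements of positive degree that form a regular sequence on $S$ (in particular $(F_1,\dots,F_n)S\neq S$), and put $Q=(F_1,\dots,F_n)S$. A homomorphism $R\to T$ of commutative rings has the *prime extension property* if for every prime ideal $P$ of $R$ the ideal $PT$ is either prime or equal to $T$; it has the *stable prime extension property* if $R[Y_1,\dots,Y_m]\to T[Y_1,\dots,Y_m]$ has the prime extension property for every $m\ge 0$. If $Q$ is a prime ideal of $S$, then the $K$-algebra homomorphism $K[X_1,\dots,X_n]\to S$, $X_i\mapsto F_i$, has the stable prime extension property. Conversely, if this homomorphism has the stable prime extension property, then $Q$ is prime. Thus the stable prime extension property is equivalent to the single closed fiber $S/Q$ over the origin being a domain. -/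

import Mathlib

/-- A homomorphism `f : R → S` of commutative rings has the prime extension property if, for every
prime ideal `P` of `R`, the expansion `PS` is a prime ideal of `S` or the unit ideal of `S`. -/
def PrimeExtensionProperty {R S : Type*} [CommRing R] [CommRing S] (f : R →+* S) : Prop :=
  ∀ P : Ideal R, P.IsPrime → (P.map f).IsPrime ∨ P.map f = ⊤

/-- A homomorphism `f : R → S` of commutative rings has the stable prime extension property if, for
every finite set of indeterminates `X₁, …, Xₘ` (possibly empty), the induced homomorphism
`R[X₁, …, Xₘ] → S[X₁, …, Xₘ]` has the prime extension property. -/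
def StablePrimeExtensionProperty {R S : Type*} [CommRing R] [CommRing S] (f : R →+* S) : Prop :=
  ∀ m : ℕ, PrimeExtensionProperty
    (MvPolynomial.map f : MvPolynomial (Fin m) R →+* MvPolynomial (Fin m) S)

/-! Let P be a prime of K[X][Y] and D = K[X][Y]/P, with x_i the class of X_i. Then S[Y]/PS[Y] is (D
⊗ S)/(1 ⊗ F_i - x_i ⊗ 1), so it suffices that these elements generate a prime ideal. Grade D ⊗ S
with D in degree 0. The 1 ⊗ F_i remain weakly regular by flatness, and they generate a prime because
D ⊗ (S/Q) is a domain, K being algebraically closed.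

It remains to translate by the degree-0 constants x_i (`isPrime_span_sub_algebraMap`). Koszul
syzygies show that top forms of elements of the translated ideal lie in the original one. Elements
outside the translated ideal have representatives whose top forms avoid the original prime, and so
does the product of these forms.

Conversely, Q is the extension of the prime (X_1, ..., X_n), and regularity makes it proper. -/

/-! ### Koszul syzygies of a weakly regular sequence. -/

theorem RingTheory.Sequence.isWeaklyRegular_ofFn_succ {A : Type*} [CommRing A] {n : ℕ}
    {F : Fin (n + 1) → A} (h : IsWeaklyRegular A (List.ofFn F)) :
    IsWeaklyRegular A (List.ofFn fun i : Fin n => F i.castSucc) ∧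
      ∀ x, x * F (Fin.last n) ∈ Ideal.span (Set.range fun i : Fin n => F i.castSucc) →
        x ∈ Ideal.span (Set.range fun i : Fin n => F i.castSucc) := by
  rw [List.ofFn_succ', List.concat_eq_append, isWeaklyRegular_append_iff,
    isWeaklyRegular_singleton_iff] at h
  refine ⟨h.1, fun x hx => ?_⟩
  have key : Ideal.ofList (List.ofFn fun i : Fin n => F i.castSucc) • (⊤ : Submodule A A) =
      Ideal.span (Set.range fun i : Fin n => F i.castSucc) := by
    rw [smul_eq_mul, Ideal.mul_top, Ideal.ofList]
    congr 1
    ext y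
    simp [List.mem_ofFn]
  rw [← key] at hx ⊢
  rw [← Submodule.Quotient.mk_eq_zero] at hx ⊢
  rw [mul_comm, ← smul_eq_mul, Submodule.Quotient.mk_smul] at hx
  exact h.2 (hx.trans (smul_zero _).symm)

/-- The syzygies of a weakly regular sequence are generated by the Koszul syzygies. -/
theorem RingTheory.Sequence.IsWeaklyRegular.exists_koszul {A : Type*} [CommRing A] {n : ℕ}
    {F : Fin n → A} (h : IsWeaklyRegular A (List.ofFn F)) (g : Fin n → A)
    (hg : ∑ i, g i * F i = 0) :
    ∃ c : Fin n → Fin n → A, ∀ i, g i = ∑ j, (c i j - c j i) * F j := by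
  induction n with
  | zero => exact ⟨fun _ _ => 0, fun i => i.elim0⟩
  | succ n ih =>
    obtain ⟨h1, h2⟩ := isWeaklyRegular_ofFn_succ h
    rw [Fin.sum_univ_castSucc] at hg
    have hlast : g (Fin.last n) ∈ Ideal.span (Set.range fun i : Fin n => F i.castSucc) := by
      apply h2
      rw [eq_neg_of_add_eq_zero_right hg]
      exact neg_mem (Ideal.sum_mem _ fun i _ =>
        Ideal.mul_mem_left _ _ (Ideal.subset_span ⟨i, rfl⟩))
    obtain ⟨e, he⟩ := (Ideal.mem_span_range_iff_exists_fun).1 hlast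
    -- Substituting the expansion of the last coefficient turns the relation into one among the
    -- first `n` elements.
    obtain ⟨c, hc⟩ := ih h1 (fun i => g i.castSucc + e i * F (Fin.last n)) (by
      rw [← hg, ← he, Finset.sum_mul, ← Finset.sum_add_distrib]
      exact Finset.sum_congr rfl fun i _ => by ring)
    -- Border `c` by the last row `e` and a zero last column; antisymmetrizing supplies the
    -- correction `-e i * F (Fin.last n)`.
    refine ⟨Fin.lastCases (Fin.lastCases 0 e) fun i => Fin.lastCases 0 (c i), ?_⟩
    intro i
    induction i using Fin.lastCases with
    | last => simp [Fin.sum_univ_castSucc, he]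
    | cast i =>
      have := hc i
      simp only [Fin.sum_univ_castSucc, Fin.lastCases_castSucc, Fin.lastCases_last]
      rw [← this]
      ring

theorem sum_sum_sub_swap_mul_mul_eq_zero {A ι : Type*} [CommRing A] [Fintype ι] (c : ι → ι → A)
    (y : ι → A) : ∑ i, (∑ j, (c i j - c j i) * y j) * y i = 0 := by
  simp only [sub_mul, Finset.sum_sub_distrib, Finset.sum_mul]
  rw [sub_eq_zero, Finset.sum_comm]
  exact Finset.sum_congr rfl fun i _ => Finset.sum_congr rfl fun j _ => by ring

/-! ### Top forms and translation by constants of degree 0. -/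

section Graded

variable {D A : Type*} [CommRing D] [CommRing A] [Algebra D A] (𝒜 : ℕ → Submodule D A)
  [GradedAlgebra 𝒜]

/-- The component of degree `m - e`, which is zero if `m < e`. -/
noncomputable def GradedAlgebra.projSub (m e : ℕ) : A →ₗ[D] A :=
  if e ≤ m then GradedAlgebra.proj 𝒜 (m - e) else 0

namespace GradedAlgebra

variable {𝒜}

theorem proj_mem (k : ℕ) (x : A) : proj 𝒜 k x ∈ 𝒜 k := by
  rw [proj_apply]; exact SetLike.coe_mem _

theorem proj_of_mem {k : ℕ} {x : A} (hx : x ∈ 𝒜 k) : proj 𝒜 k x = x := by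
  rw [proj_apply]; exact DirectSum.decompose_of_mem_same 𝒜 hx

theorem proj_of_mem_ne {k l : ℕ} {x : A} (hx : x ∈ 𝒜 k) (h : k ≠ l) : proj 𝒜 l x = 0 := by
  rw [proj_apply]; exact DirectSum.decompose_of_mem_ne 𝒜 hx h

theorem proj_projSub {m e k : ℕ} (x : A) (h : k + e ≠ m) : proj 𝒜 k (projSub 𝒜 m e x) = 0 := by
  unfold projSub
  split_ifs with he
  · exact proj_of_mem_ne (proj_mem _ _) (by omega)
  · simp

theorem proj_projSub_self {k e : ℕ} (x : A) :
    proj 𝒜 k (projSub 𝒜 (k + e) e x) = proj 𝒜 k x := by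
  unfold projSub
  rw [if_pos (Nat.le_add_left _ _), Nat.add_sub_cancel]
  exact proj_of_mem (proj_mem _ _)

theorem projSub_projSub (m e : ℕ) (x : A) : projSub 𝒜 m e (projSub 𝒜 m e x) = projSub 𝒜 m e x := by
  unfold projSub
  split_ifs with he
  · exact proj_of_mem (proj_mem _ _)
  · simp

theorem proj_mul {k e : ℕ} (x : A) {f : A} (hf : f ∈ 𝒜 e) :
    proj 𝒜 k (x * f) = projSub 𝒜 k e x * f := by
  unfold projSub
  rw [proj_apply, DirectSum.coe_decompose_mul_of_right_mem 𝒜 k hf]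
  split_ifs <;> simp [proj_apply]

theorem projSub_mul {k e e' : ℕ} (x : A) {f : A} (hf : f ∈ 𝒜 e') :
    projSub 𝒜 k e (x * f) = projSub 𝒜 k (e + e') x * f := by
  by_cases he : e ≤ k
  · rw [projSub, if_pos he, proj_mul x hf]
    congr 2
    unfold projSub
    by_cases h : e + e' ≤ k
    · rw [if_pos h, if_pos (by omega), Nat.sub_sub]
    · rw [if_neg h, if_neg (by omega)]
  · rw [projSub, projSub, if_neg he, if_neg (by omega)]; simp

theorem eq_zero_of_proj_eq_zero {x : A} (h : ∀ k, proj 𝒜 k x = 0) : x = 0 := by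
  apply (DirectSum.decompose 𝒜).injective
  rw [DirectSum.decompose_zero]
  ext k
  simpa [proj_apply] using h k

theorem exists_proj_eq_zero (x : A) : ∃ N, ∀ k, N ≤ k → proj 𝒜 k x = 0 := by
  classical
  refine ⟨((DirectSum.decompose 𝒜 x).support.sup id) + 1, fun k hk => ?_⟩
  by_contra hne
  have : k ∈ (DirectSum.decompose 𝒜 x).support := by
    rw [DFinsupp.mem_support_iff]
    intro h0
    apply hne
    rw [proj_apply, h0]; rfl
  have := Finset.le_sup (f := id) this
  simp only [id] at this
  omega

theorem proj_mul_of_proj_eq_zero {p q : ℕ} {x y : A} (hx : ∀ k, p < k → proj 𝒜 k x = 0)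
    (hy : ∀ k, q < k → proj 𝒜 k y = 0) : proj 𝒜 (p + q) (x * y) = proj 𝒜 p x * proj 𝒜 q y := by
  rw [proj_apply, DirectSum.decompose_mul, DirectSum.coe_mul_apply_eq_sum_antidiagonal]
  simp only [← proj_apply]
  refine Finset.sum_eq_single (p, q) (fun ij hij hne => ?_) (fun h => by simp at h)
  rw [Finset.HasAntidiagonal.mem_antidiagonal] at hij
  rcases lt_trichotomy ij.1 p with h | h | h
  · rw [hy _ (by omega), mul_zero]
  · exact absurd (Prod.ext h (by simp; omega)) hne
  · rw [hx _ h, zero_mul]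

variable {n : ℕ} {F : Fin n → A} {d : Fin n → ℕ} (hd : ∀ i, 0 < d i) (hF : ∀ i, F i ∈ 𝒜 (d i))
  (a : Fin n → D)

include hd hF

/-- If the coefficients of a representation of `w` reach a degree above `m`, their top parts form a
syzygy of `F`. Subtracting the matching Koszul syzygy of the translated elements lowers that degree
without changing `w`. -/
theorem proj_mem_span_of_mem_span_sub
    (hreg : RingTheory.Sequence.IsWeaklyRegular A (List.ofFn F)) {w : A} {m : ℕ}
    (hw : w ∈ Ideal.span (Set.range fun i => F i - algebraMap D A (a i)))
    (hwm : ∀ k, m < k → proj 𝒜 k w = 0) : proj 𝒜 m w ∈ Ideal.span (Set.range F) := by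
  -- `N` strictly bounds the degrees of the terms `g i * F i`; the terms `a i * g i` have even lower
  -- degree because `d i > 0`.
  suffices H : ∀ N : ℕ, ∀ g : Fin n → A, ∑ i, g i * (F i - algebraMap D A (a i)) = w →
      (∀ i k, N ≤ k + d i → proj 𝒜 k (g i) = 0) → proj 𝒜 m w ∈ Ideal.span (Set.range F) by
    obtain ⟨g, hg⟩ := Ideal.mem_span_range_iff_exists_fun.1 hw
    choose N hN using fun i => exists_proj_eq_zero (𝒜 := 𝒜) (g i)
    refine H (∑ i, (N i + d i)) g hg fun i k hk => hN i k ?_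
    have := Finset.single_le_sum (f := fun i => N i + d i) (fun _ _ => Nat.zero_le _)
      (Finset.mem_univ i)
    omega
  have hproj : ∀ (g : Fin n → A) (M : ℕ), ∑ i, g i * (F i - algebraMap D A (a i)) = w →
      (∀ i k, M < k + d i → proj 𝒜 k (g i) = 0) →
      proj 𝒜 M w = ∑ i, projSub 𝒜 M (d i) (g i) * F i := by
    intro g M hg hv
    rw [← hg, map_sum]
    refine Finset.sum_congr rfl fun i _ => ?_
    rw [mul_sub, map_sub, proj_mul _ (hF i), mul_comm (g i) (algebraMap D A _),
      ← Algebra.smul_def, map_smul, hv i M (by have := hd i; omega), smul_zero, sub_zero]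
  have hle : ∀ (g : Fin n → A) (M : ℕ), ∑ i, projSub 𝒜 M (d i) (g i) * F i ∈
      Ideal.span (Set.range F) := fun g M =>
    Ideal.sum_mem _ fun i _ => Ideal.mul_mem_left _ _ (Ideal.subset_span ⟨i, rfl⟩)
  intro N
  induction N with
  | zero =>
    intro g hg hv
    rw [hproj g m hg fun i k _ => hv i k (Nat.zero_le _)]
    exact hle g m
  | succ M ih =>
    intro g hg hv
    by_cases hMm : M ≤ m
    · rw [hproj g m hg fun i k hk => hv i k (by omega)]
      exact hle g m
    have h0 := hproj g M hg fun i k hk => hv i k hk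
    rw [hwm M (by omega)] at h0
    obtain ⟨c, hc⟩ := hreg.exists_koszul _ h0.symm
    -- Only the part of degree `M - d i - d j` matters, so the Koszul coefficients may be taken
    -- homogeneous.
    let c' : Fin n → Fin n → A := fun i j => projSub 𝒜 M (d i + d j) (c i j)
    have hc' : ∀ i, projSub 𝒜 M (d i) (g i) = ∑ j, (c' i j - c' j i) * F j := by
      intro i
      rw [← projSub_projSub, hc i, map_sum]
      refine Finset.sum_congr rfl fun j _ => ?_
      rw [projSub_mul _ (hF j), map_sub]
      simp only [c', add_comm (d j)]
    refine ih (fun i => g i - ∑ j, (c' i j - c' j i) * (F j - algebraMap D A (a j))) ?_ ?_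
    · rw [← hg, ← sub_zero (∑ i, g i * _),
        ← sum_sum_sub_swap_mul_mul_eq_zero c' fun i => F i - algebraMap D A (a i),
        ← Finset.sum_sub_distrib]
      exact Finset.sum_congr rfl fun i _ => sub_mul _ _ _
    · intro i k hk
      have e : g i - ∑ j, (c' i j - c' j i) * (F j - algebraMap D A (a j)) =
          g i - projSub 𝒜 M (d i) (g i) + ∑ j, a j • (c' i j - c' j i) := by
        rw [hc' i]
        simp only [mul_sub, Finset.sum_sub_distrib, Algebra.smul_def, mul_comm (algebraMap D A _)]
        ring
      rw [e, map_add, map_sub, map_sum, Finset.sum_eq_zero, add_zero]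
      · rcases Nat.eq_or_lt_of_le hk with rfl | hlt
        · rw [proj_projSub_self, sub_self]
        · rw [hv i k hlt, proj_projSub _ (by omega), sub_zero]
      · intro j _
        have := hd j
        rw [map_smul, map_sub, proj_projSub _ (by omega), proj_projSub _ (by omega), sub_zero,
          smul_zero]

/-- While the top form lies in the ideal of `F`, replacing each `F i` by `a i` in a homogeneous
expansion of it lowers the degree and preserves the class of `u`. -/
theorem mem_span_sub_or_exists_proj_notMem (u : A) :
    u ∈ Ideal.span (Set.range fun i => F i - algebraMap D A (a i)) ∨
      ∃ u' p, u - u' ∈ Ideal.span (Set.range fun i => F i - algebraMap D A (a i)) ∧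
        (∀ k, p < k → proj 𝒜 k u' = 0) ∧ proj 𝒜 p u' ∉ Ideal.span (Set.range F) := by
  obtain ⟨N, hN⟩ := exists_proj_eq_zero (𝒜 := 𝒜) u
  induction N generalizing u with
  | zero =>
    left
    rw [eq_zero_of_proj_eq_zero (𝒜 := 𝒜) fun k => hN k (Nat.zero_le k)]
    exact zero_mem _
  | succ m ih =>
    by_cases hm : proj 𝒜 m u ∈ Ideal.span (Set.range F)
    · obtain ⟨g, hg⟩ := Ideal.mem_span_range_iff_exists_fun.1 hm
      have hg' : ∑ i, projSub 𝒜 m (d i) (g i) * F i = proj 𝒜 m u := by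
        rw [← proj_of_mem (proj_mem m u), ← hg, map_sum]
        exact Finset.sum_congr rfl fun i _ => (proj_mul _ (hF i)).symm
      set v := ∑ i, projSub 𝒜 m (d i) (g i) * (F i - algebraMap D A (a i)) with hv
      have hvI : v ∈ Ideal.span (Set.range fun i => F i - algebraMap D A (a i)) :=
        Ideal.sum_mem _ fun i _ => Ideal.mul_mem_left _ _ (Ideal.subset_span ⟨i, rfl⟩)
      have hv' : v = proj 𝒜 m u - ∑ i, a i • projSub 𝒜 m (d i) (g i) := by
        rw [hv, ← hg']
        simp only [mul_sub, Finset.sum_sub_distrib, Algebra.smul_def, mul_comm (algebraMap D A _)]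
      have huv : ∀ k, m ≤ k → proj 𝒜 k (u - v) = 0 := by
        intro k hk
        have hs : proj 𝒜 k (∑ i, a i • projSub 𝒜 m (d i) (g i)) = 0 := by
          rw [map_sum]
          refine Finset.sum_eq_zero fun i _ => ?_
          have := hd i
          rw [map_smul, proj_projSub _ (by omega), smul_zero]
        rw [hv', map_sub, map_sub, hs, sub_zero]
        rcases Nat.eq_or_lt_of_le hk with rfl | hlt
        · rw [proj_of_mem (proj_mem _ _), sub_self]
        · rw [hN k hlt, proj_of_mem_ne (proj_mem m u) hlt.ne, sub_zero]
      rcases ih (u - v) huv with h | ⟨u', p, h1, h2, h3⟩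
      · left
        simpa using add_mem h hvI
      · refine Or.inr ⟨u', p, ?_, h2, h3⟩
        have := add_mem h1 hvI
        rwa [show u - v - u' + v = u - u' by ring] at this
    · exact Or.inr ⟨u, m, by simp, fun k hk => hN k hk, hm⟩

/-- If a regular sequence of forms of positive degree generates a prime ideal, then so does
every translate of it by constants. -/
theorem isPrime_span_sub_algebraMap
    (hreg : RingTheory.Sequence.IsWeaklyRegular A (List.ofFn F))
    (hprime : (Ideal.span (Set.range F)).IsPrime) :
    (Ideal.span (Set.range fun i => F i - algebraMap D A (a i))).IsPrime := by
  refine ⟨fun htop => ?_, fun {u v} huv => ?_⟩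
  · have h1 : (1 : A) ∈ 𝒜 0 := SetLike.GradedOne.one_mem
    have := proj_mem_span_of_mem_span_sub hd hF a hreg (w := 1) (m := 0) (by rw [htop]; trivial)
      fun k hk => proj_of_mem_ne h1 hk.ne
    rw [proj_of_mem h1] at this
    exact hprime.ne_top ((Ideal.eq_top_iff_one _).2 this)
  · rcases mem_span_sub_or_exists_proj_notMem hd hF a u with h | ⟨u', p, hu1, hu2, hu3⟩
    · exact Or.inl h
    rcases mem_span_sub_or_exists_proj_notMem hd hF a v with h | ⟨v', q, hv1, hv2, hv3⟩
    · exact Or.inr h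
    exfalso
    have huv' : u' * v' ∈ Ideal.span (Set.range fun i => F i - algebraMap D A (a i)) := by
      have := sub_mem huv (add_mem (Ideal.mul_mem_right v _ hu1) (Ideal.mul_mem_left _ u' hv1))
      rwa [show u * v - ((u - u') * v + u' * (v - v')) = u' * v' by ring] at this
    have := proj_mem_span_of_mem_span_sub hd hF a hreg huv' (m := p + q) (by
      intro k hk
      rw [proj_apply, DirectSum.decompose_mul, DirectSum.coe_mul_apply_eq_sum_antidiagonal]
      simp only [← proj_apply]
      refine Finset.sum_eq_zero fun ij hij => ?_
      rw [Finset.HasAntidiagonal.mem_antidiagonal] at hij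
      rcases lt_or_ge p ij.1 with h | h
      · rw [hu2 _ h, zero_mul]
      · rw [hv2 _ (by omega), mul_zero])
    rw [proj_mul_of_proj_eq_zero hu2 hv2] at this
    exact (hprime.mem_or_mem this).elim hu3 hv3

end GradedAlgebra

end Graded

/-! ### Base change to a finitely generated domain. -/

open scoped TensorProduct

/-- Over an algebraically closed field, a tensor product of two domains, one of them of finite
type, has no zero divisors. -/
theorem Algebra.TensorProduct.isDomain_of_finiteType (K D B : Type*) [Field K] [IsAlgClosed K]
    [CommRing D] [Algebra K D] [IsDomain D] [Algebra.FiniteType K D] [CommRing B] [Algebra K B]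
    [IsDomain B] : IsDomain (D ⊗[K] B) := by
  let b := Module.Basis.ofVectorSpace K B
  let bD := Algebra.TensorProduct.basis D b
  -- Specialization at a K-point of D lands in the domain B and acts coordinatewise in a K-basis of
  -- B.
  have hev : ∀ (φ : D →ₐ[K] K) (u : D ⊗[K] B),
      Algebra.TensorProduct.lift ((Algebra.ofId K B).comp φ) (AlgHom.id K B)
        (fun _ _ => Commute.all _ _) u = 0 ↔ ∀ i, φ (bD.repr u i) = 0 := by
    intro φ u
    have : ∀ i, b.repr (Algebra.TensorProduct.lift ((Algebra.ofId K B).comp φ) (AlgHom.id K B)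
        (fun _ _ => Commute.all _ _) u) i = φ (bD.repr u i) := by
      intro i
      induction u using TensorProduct.induction_on with
      | zero => simp
      | tmul x y =>
        have h : φ x • y = algebraMap K B (φ x) * y := Algebra.smul_def _ _
        simp [bD, Algebra.TensorProduct.basis_repr_tmul, Algebra.ofId_apply, ← h]
      | add x y hx hy => simp only [map_add, Finsupp.add_apply, hx, hy]
    simp only [← this]
    rw [← b.repr.map_eq_zero_iff, Finsupp.ext_iff]
    simp
  -- Nullstellensatz: every maximal ideal comes from a K-point.
  have hmax : ∀ m : Ideal D, m.IsMaximal → ∃ φ : D →ₐ[K] K, ∀ x, φ x = 0 ↔ x ∈ m := by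
    intro m hm
    let _ : Field (D ⧸ m) := Ideal.Quotient.field m
    have : Module.Finite K (D ⧸ m) := finite_of_finite_type_of_isJacobsonRing K (D ⧸ m)
    let e : K ≃ₐ[K] (D ⧸ m) := AlgEquiv.ofBijective (Algebra.ofId K (D ⧸ m))
      IsAlgClosed.algebraMap_bijective_of_isIntegral
    refine ⟨e.symm.toAlgHom.comp (Ideal.Quotient.mkₐ K m), fun x => ?_⟩
    simp [Ideal.Quotient.eq_zero_iff_mem]
  have : IsJacobsonRing D := isJacobsonRing_of_finiteType (A := K)
  have hjac : (⊥ : Ideal D).jacobson = ⊥ := by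
    rw [← Ideal.radical_eq_jacobson]
    exact (Ideal.isPrime_bot (α := D)).isRadical.radical
  have : Nontrivial (D ⊗[K] B) :=
    Algebra.TensorProduct.nontrivial_of_algebraMap_injective_of_isDomain K D B
      (algebraMap K D).injective (algebraMap K B).injective
  have : NoZeroDivisors (D ⊗[K] B) := by
    refine ⟨fun {u v} huv => ?_⟩
    by_contra! hne
    obtain ⟨hu, hv⟩ := hne
    obtain ⟨i, hi⟩ : ∃ i, bD.repr u i ≠ 0 := by
      by_contra! h
      exact hu (bD.repr.map_eq_zero_iff.1 (Finsupp.ext h))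
    obtain ⟨j, hj⟩ : ∃ j, bD.repr v j ≠ 0 := by
      by_contra! h
      exact hv (bD.repr.map_eq_zero_iff.1 (Finsupp.ext h))
    -- At each K-point one factor specializes to zero, so the product of these coordinates lies in
    -- the Jacobson radical, which vanishes.
    apply mul_ne_zero hi hj
    rw [← Ideal.mem_bot, ← hjac, Ideal.jacobson, Ideal.mem_sInf]
    rintro m ⟨-, hm⟩
    obtain ⟨φ, hφ⟩ := hmax m hm
    rw [← hφ, map_mul]
    have h0 := congrArg (Algebra.TensorProduct.lift ((Algebra.ofId K B).comp φ) (AlgHom.id K B)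
        (fun _ _ => Commute.all _ _)) huv
    rw [map_mul, map_zero] at h0
    rcases mul_eq_zero.1 h0 with h | h
    · rw [(hev φ u).1 h i, zero_mul]
    · rw [(hev φ v).1 h j, mul_zero]
  exact NoZeroDivisors.to_isDomain _

theorem Ideal.isPrime_span_range_one_tmul {K D S ι : Type*} [Field K] [IsAlgClosed K]
    [CommRing D] [Algebra K D] [IsDomain D] [Algebra.FiniteType K D] [CommRing S] [Algebra K S]
    (F : ι → S) (h : (Ideal.span (Set.range F)).IsPrime) :
    (Ideal.span (Set.range fun i => (1 : D) ⊗ₜ[K] F i)).IsPrime := by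
  have := Algebra.TensorProduct.isDomain_of_finiteType K D (S ⧸ Ideal.span (Set.range F))
  have hk := Algebra.TensorProduct.lTensor_ker (A := D)
    (Ideal.Quotient.mkₐ K (Ideal.span (Set.range F))) (Ideal.Quotient.mkₐ_surjective K _)
  have hk' : RingHom.ker (Ideal.Quotient.mkₐ K (Ideal.span (Set.range F))) =
      Ideal.span (Set.range F) := Ideal.Quotient.mkₐ_ker K _
  rw [hk', Ideal.map_span, ← Set.range_comp] at hk
  have e : (fun i => (1 : D) ⊗ₜ[K] F i) =
    ⇑(Algebra.TensorProduct.includeRight : S →ₐ[K] D ⊗[K] S) ∘ F := rfl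
  rw [e, ← hk]
  exact RingHom.ker_isPrime _

theorem RingTheory.Sequence.IsWeaklyRegular.one_tmul {K D S : Type*} [Field K]
    [CommRing D] [Algebra K D] [CommRing S] [Algebra K S] {n : ℕ} {F : Fin n → S}
    (h : IsWeaklyRegular S (List.ofFn F)) :
    IsWeaklyRegular (D ⊗[K] S) (List.ofFn fun i => (1 : D) ⊗ₜ[K] F i) := by
  have h1 := h.of_flat (S := S ⊗[K] D)
  refine ((Algebra.TensorProduct.comm K S D).toAddEquiv.isWeaklyRegular_congr ?_).1 h1
  rw [List.map_ofFn, List.forall₂_iff_get]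
  refine ⟨by simp, fun i h1 h2 x => ?_⟩
  simp [Algebra.TensorProduct.algebraMap_apply]

/-! ### Ingredients of the converse. -/

theorem PrimeExtensionProperty.of_stable {R T : Type*} [CommRing R] [CommRing T] {f : R →+* T}
    (h : StablePrimeExtensionProperty f) : PrimeExtensionProperty f := by
  intro P hP
  let eR := MvPolynomial.isEmptyRingEquiv R (Fin 0)
  let eT := MvPolynomial.isEmptyRingEquiv T (Fin 0)
  have hcomp : (MvPolynomial.map f).comp (eR.symm : R →+* MvPolynomial (Fin 0) R) =
      (eT.symm : T →+* MvPolynomial (Fin 0) T).comp f := by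
    refine RingHom.ext fun x => eT.injective ?_
    obtain ⟨z, rfl⟩ := eR.surjective x
    obtain ⟨w, rfl⟩ := MvPolynomial.C_surjective (Fin 0) z
    simp [eR, eT]
  have hPr : (P.map (eR.symm : R →+* MvPolynomial (Fin 0) R)).IsPrime :=
    Ideal.map_isPrime_of_equiv eR.symm
  have := h 0 _ hPr
  rw [Ideal.map_map, hcomp, ← Ideal.map_map] at this
  have key : ((P.map f).map (eT.symm : T →+* MvPolynomial (Fin 0) T)).map
      (eT : MvPolynomial (Fin 0) T →+* T) = P.map f := by
    rw [Ideal.map_map]; simp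
  rcases this with h1 | h1
  · left
    rw [← key]
    exact Ideal.map_isPrime_of_equiv eT
  · right
    rw [← key, h1, Ideal.map_top]

theorem MvPolynomial.isPrime_span_range_X (σ K : Type*) [CommRing K] [IsDomain K] :
    (Ideal.span (Set.range (X : σ → MvPolynomial σ K))).IsPrime := by
  have h : Ideal.span (Set.range (X : σ → MvPolynomial σ K)) =
      RingHom.ker (constantCoeff : MvPolynomial σ K →+* K) := by
    apply le_antisymm
    · rw [Ideal.span_le]
      rintro _ ⟨i, rfl⟩
      simp [RingHom.mem_ker]
    · have key : ∀ p : MvPolynomial σ K,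
          p - C (constantCoeff p) ∈ Ideal.span (Set.range (X : σ → MvPolynomial σ K)) := by
        intro p
        induction p using MvPolynomial.induction_on with
        | C r => simp
        | add p q hp hq =>
          have := add_mem hp hq
          rwa [sub_add_sub_comm, ← C_add, ← map_add] at this
        | mul_X p i _ =>
          simpa using Ideal.mul_mem_left _ p (Ideal.subset_span (Set.mem_range_self i))
      intro p hp
      simpa [(RingHom.mem_ker).1 hp] using key p
  rw [h]
  exact RingHom.ker_isPrime _

/-! ### Extended primes as kernels of maps to translated fibers. -/

theorem isPrime_span_range_one_tmul_sub_tmul_one {K D S : Type*} [Field K] [IsAlgClosed K]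
    [CommRing D] [Algebra K D] [IsDomain D] [Algebra.FiniteType K D] [CommRing S] [Algebra K S]
    (𝒜 : ℕ → Submodule K S) [GradedAlgebra 𝒜] {n : ℕ} {F : Fin n → S}
    {d : Fin n → ℕ} (hd : ∀ i, 0 < d i) (hF : ∀ i, F i ∈ 𝒜 (d i))
    (hreg : RingTheory.Sequence.IsWeaklyRegular S (List.ofFn F))
    (hQ : (Ideal.span (Set.range F)).IsPrime) (x : Fin n → D) :
    (Ideal.span (Set.range fun i => (1 : D) ⊗ₜ[K] F i - x i ⊗ₜ[K] (1 : S))).IsPrime :=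
  GradedAlgebra.isPrime_span_sub_algebraMap
    (𝒜 := fun i => (𝒜 i).baseChange D) (F := fun i => (1 : D) ⊗ₜ[K] F i) hd
    (fun i => Submodule.tmul_mem_baseChange_of_mem _ (hF i)) x hreg.one_tmul
    (Ideal.isPrime_span_range_one_tmul F hQ)

-- Here `D` plays the role of the quotient by `P`. Since `ψ ∘ Φ` factors through `π`, the kernel of
-- `ψ` contains the extension of `P`; the map induced by `θ` recovers the quotient map from `ψ`,
-- giving the other inclusion.
open MvPolynomial in
theorem isPrime_map_of_algHom {K D S : Type*} [Field K] [IsAlgClosed K] [CommRing D]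
    [Algebra K D] [IsDomain D] [Algebra.FiniteType K D] [CommRing S]
    [Algebra K S] (𝒜 : ℕ → Submodule K S) [GradedAlgebra 𝒜] {n m : ℕ} {F : Fin n → S}
    {d : Fin n → ℕ} (hd : ∀ i, 0 < d i) (hF : ∀ i, F i ∈ 𝒜 (d i))
    (hreg : RingTheory.Sequence.IsWeaklyRegular S (List.ofFn F))
    (hQ : (Ideal.span (Set.range F)).IsPrime)
    (Φ : MvPolynomial (Fin m) (MvPolynomial (Fin n) K) →+* MvPolynomial (Fin m) S)
    (hΦ : Φ = MvPolynomial.map (aeval F : MvPolynomial (Fin n) K →ₐ[K] S).toRingHom)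
    (P : Ideal (MvPolynomial (Fin m) (MvPolynomial (Fin n) K)))
    (π : MvPolynomial (Fin m) (MvPolynomial (Fin n) K) →ₐ[K] D) (hπ : ∀ p ∈ P, π p = 0)
    (σ : D →ₐ[K] MvPolynomial (Fin m) S ⧸ P.map Φ)
    (hσ : ∀ p, σ (π p) = Ideal.Quotient.mk _ (Φ p)) : (P.map Φ).IsPrime := by
  have hΦF : ∀ i, Φ (C (X i)) = C (F i) := fun i => by simp [hΦ]
  have hΦX : ∀ j, Φ (X j) = X j := fun j => by simp [hΦ]
  let I : Ideal (D ⊗[K] S) :=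
    Ideal.span (Set.range fun i => (1 : D) ⊗ₜ[K] F i - π (C (X i)) ⊗ₜ[K] (1 : S))
  have hI : I.IsPrime :=
    isPrime_span_range_one_tmul_sub_tmul_one 𝒜 hd hF hreg hQ fun i => π (C (X i))
  let ψ : MvPolynomial (Fin m) S →+* (D ⊗[K] S) ⧸ I :=
    eval₂Hom ((Ideal.Quotient.mk I).comp
      (Algebra.TensorProduct.includeRight : S →ₐ[K] D ⊗[K] S).toRingHom)
      (fun j => Ideal.Quotient.mk I (π (X j) ⊗ₜ[K] (1 : S)))
  let θ : D ⊗[K] S →ₐ[K] MvPolynomial (Fin m) S ⧸ P.map Φ :=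
    Algebra.TensorProduct.lift σ
      ((Ideal.Quotient.mkₐ K (P.map Φ)).comp (IsScalarTower.toAlgHom K S (MvPolynomial (Fin m) S)))
      (fun _ _ => Commute.all _ _)
  have hψΦ : ψ.comp Φ = (Ideal.Quotient.mk I).comp
      ((Algebra.TensorProduct.includeLeft : D →ₐ[K] D ⊗[K] S).toRingHom.comp π.toRingHom) := by
    refine ringHom_ext' (ringHom_ext (fun r => ?_) fun i => ?_) fun j => ?_
    · have h1 : Φ (C (C r)) = C (algebraMap K S r) := by simp [hΦ]
      have h2 : π.toRingHom (C (C r)) = algebraMap K D r := π.commutes r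
      simp only [RingHom.comp_apply, h1, h2, ψ, coe_eval₂Hom, eval₂_C]
      congr 1
      exact (AlgHom.commutes _ r).trans (AlgHom.commutes _ r).symm
    · simp only [RingHom.comp_apply, hΦF, ψ, coe_eval₂Hom, eval₂_C]
      exact Ideal.Quotient.eq.2 (Ideal.subset_span ⟨i, rfl⟩)
    · simp only [RingHom.comp_apply, hΦX, ψ, coe_eval₂Hom, eval₂_X]
      rfl
  have hθS : ∀ s : S, θ (1 ⊗ₜ s) = Ideal.Quotient.mk (P.map Φ) (C s) := fun s => by
    simp only [θ, Algebra.TensorProduct.lift_tmul, map_one, one_mul]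
    rfl
  have hθD : ∀ p, θ (π p ⊗ₜ[K] (1 : S)) = Ideal.Quotient.mk (P.map Φ) (Φ p) := fun p => by
    simp only [θ, Algebra.TensorProduct.lift_tmul, map_one, mul_one, hσ]
  have hθI : ∀ z ∈ I, θ z = 0 := by
    intro z hz
    have : I ≤ RingHom.ker θ := by
      rw [Ideal.span_le]
      rintro _ ⟨i, rfl⟩
      rw [SetLike.mem_coe, RingHom.mem_ker, map_sub, hθS, hθD, hΦF, sub_self]
    exact this hz
  have hθψ : (Ideal.Quotient.lift I θ.toRingHom hθI).comp ψ = Ideal.Quotient.mk (P.map Φ) := by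
    refine ringHom_ext (fun s => ?_) fun j => ?_
    · simp only [RingHom.comp_apply, ψ, coe_eval₂Hom, eval₂_C]
      exact hθS s
    · simp only [RingHom.comp_apply, ψ, coe_eval₂Hom, eval₂_X]
      exact (hθD (X j)).trans (by rw [hΦX])
  have hker : P.map Φ = RingHom.ker ψ := by
    apply le_antisymm
    · rw [Ideal.map_le_iff_le_comap]
      intro p hp
      rw [Ideal.mem_comap, RingHom.mem_ker]
      have := RingHom.congr_fun hψΦ p
      simpa [hπ p hp] using this
    · intro p hp
      rw [← Ideal.Quotient.eq_zero_iff_mem, ← hθψ, RingHom.comp_apply, (RingHom.mem_ker).1 hp,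
        map_zero]
  rw [hker]
  exact RingHom.ker_isPrime ψ

open MvPolynomial in
theorem isPrime_map_of_isPrime_span {K S : Type*} [Field K] [IsAlgClosed K] [CommRing S]
    [Algebra K S] (𝒜 : ℕ → Submodule K S) [GradedAlgebra 𝒜] {n m : ℕ} {F : Fin n → S}
    {d : Fin n → ℕ} (hd : ∀ i, 0 < d i) (hF : ∀ i, F i ∈ 𝒜 (d i))
    (hreg : RingTheory.Sequence.IsWeaklyRegular S (List.ofFn F))
    (hQ : (Ideal.span (Set.range F)).IsPrime)
    (P : Ideal (MvPolynomial (Fin m) (MvPolynomial (Fin n) K))) [P.IsPrime] :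
    (P.map (MvPolynomial.map (aeval F : MvPolynomial (Fin n) K →ₐ[K] S).toRingHom)).IsPrime := by
  have : Algebra.FiniteType K (MvPolynomial (Fin m) (MvPolynomial (Fin n) K)) :=
    Algebra.FiniteType.trans (S := MvPolynomial (Fin n) K) inferInstance inferInstance
  let Φ := MvPolynomial.map (σ := Fin m) (aeval F : MvPolynomial (Fin n) K →ₐ[K] S).toRingHom
  let τ : MvPolynomial (Fin m) (MvPolynomial (Fin n) K) →ₐ[K] MvPolynomial (Fin m) S ⧸ P.map Φ :=
    (Ideal.Quotient.mkₐ K (P.map Φ)).comp (mapAlgHom (aeval F))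
  have hτ : ∀ p, τ p = Ideal.Quotient.mk (P.map Φ) (Φ p) := fun _ => rfl
  refine isPrime_map_of_algHom (D := MvPolynomial (Fin m) (MvPolynomial (Fin n) K) ⧸ P)
    𝒜 hd hF hreg hQ Φ rfl P (Ideal.Quotient.mkₐ K P)
    (fun _ hp => Ideal.Quotient.eq_zero_iff_mem.2 hp)
    (Ideal.Quotient.liftₐ P τ fun p hp => ?_) fun p => ?_
  · rw [hτ]
    exact Ideal.Quotient.eq_zero_iff_mem.2 (Ideal.mem_map_of_mem _ hp)
  · rw [← hτ]
    rfl

theorem mainTheorem5 {K S : Type*} [Field K] [IsAlgClosed K] [CommRing S] [Algebra K S]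
    (𝒜 : ℕ → Submodule K S) [GradedAlgebra 𝒜]
    (n : ℕ) (F : Fin n → S) (d : Fin n → ℕ) (hd : ∀ i, 0 < d i) (hF : ∀ i, F i ∈ 𝒜 (d i))
    (hreg : RingTheory.Sequence.IsRegular S (List.ofFn F)) :
    (Ideal.span (Set.range F)).IsPrime ↔
      StablePrimeExtensionProperty
        (MvPolynomial.aeval F : MvPolynomial (Fin n) K →ₐ[K] S).toRingHom := by
  refine ⟨fun hQ m P hP => Or.inl (isPrime_map_of_isPrime_span 𝒜 hd hF hreg.1 hQ P), fun h => ?_⟩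
  have hX := MvPolynomial.isPrime_span_range_X (Fin n) K
  have hmap : (Ideal.span (Set.range (MvPolynomial.X : Fin n → MvPolynomial (Fin n) K))).map
      (MvPolynomial.aeval F : MvPolynomial (Fin n) K →ₐ[K] S).toRingHom =
        Ideal.span (Set.range F) := by
    rw [Ideal.map_span, ← Set.range_comp]
    congr 2
    ext i
    simp
  have := PrimeExtensionProperty.of_stable h _ hX
  rw [hmap] at this
  refine this.resolve_right fun htop => hreg.2 ?_
  rw [smul_eq_mul, Ideal.mul_top, Ideal.ofList, ← htop]
  congr 1
  ext y
  simp [List.mem_ofFn]
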